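/- Let $T$ be a finite tree. Its (Jordan) center $Z(T)$, the set of vertices of minimum eccentricity, is either a single vertex or the set of the two ends of an edge. The rootification of $T$ is the rooted tree $(T_r,r)$ defined as follows: if $|Z(T)|=1$, then $T_r=T$ and $r$ is the vertex in the center; if $|Z(T)|=2$, then $T_r$ is obtained from $T$ by subdividing the edge between the two central vertices, and $r$ is the new vertex. For a finite simple graph $X$ with vertex coloring $c$, let $C(\mathrm{Qut}_c(X))$ be the universal unital $C^*$-algebra with generators $u_{ij}$ ($i,j\in V(X)$) and relations $$u_{ij}=u_{ij}^*=u_{ij}^2,\qquad \sum_k u_{ik}=1=\sum_k u_{kj},$$ $$u_{ij}u_{kl}=0\ \text{ if } ik\in E(X),\ jl\notin E(X)\text{ or vice versa},\qquad u_{ij}=0\ \text{ if } c(i)\neq c(j).$$ Let $\mathrm{Qut}_c(X)$ be the compact matrix quantum group given by this algebra, the fundamental representation $u=(u_{ij})$ and the comultiplication $\Delta(u_{ij})=\sum_k u_{ik}\otimes u_{kj}$ into the minimal tensor product. Write $\mathrm{Qut}(X)$ if all vertices have the same color, and $\mathrm{Qut}_r(X)$ if $X$ is a tree with root $r$, where $r$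 has one color and all other vertices have a second color. Then, for every finite tree $T$ with rootification $(T_r,r)$, $$\mathrm{Qut}(T)\cong \mathrm{Qut}_r(T_r)$$ as compact quantum groups: there is a $*$-isomorphism $\varphi: C(\mathrm{Qut}(T))\to C(\mathrm{Qut}_r(T_r))$ such that $\Delta\circ\varphi=(\varphi\otimes\varphi)\circ\Delta$. -/

import Mathlib

universe u

/-! ### C*-seminorms and the C*-algebras obtained by completion -/

/-- A C*-seminorm on a complex unital *-algebra. -/
structure CStarSeminorm (A : Type u) [Ring A] [StarRing A] [Algebra ℂ A] extends
    Seminorm ℂ A where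
  mul_le' : ∀ a b : A, toFun (a * b) ≤ toFun a * toFun b
  star_mul_self' : ∀ a : A, toFun (star a * a) = toFun a ^ 2

namespace CStarSeminorm

section Basic

variable {A : Type u} [Ring A] [StarRing A] [Algebra ℂ A]

noncomputable instance : CoeFun (CStarSeminorm A) (fun _ => A → ℝ) := ⟨fun p => p.toSeminorm⟩

theorem nonneg (p : CStarSeminorm A) (a : A) : 0 ≤ p a := apply_nonneg p.toSeminorm a

theorem map_mul_le (p : CStarSeminorm A) (a b : A) : p (a * b) ≤ p a * p b := p.mul_le' a b

theorem map_star_mul_self (p : CStarSeminorm A) (a : A) : p (star a * a) = p a ^ 2 :=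
  p.star_mul_self' a

theorem le_map_star (p : CStarSeminorm A) (a : A) : p a ≤ p (star a) := by
  have h := p.map_mul_le (star a) a
  rw [p.map_star_mul_self, sq] at h
  rcases (p.nonneg a).eq_or_lt with h0 | h0
  · rw [← h0]; exact p.nonneg _
  · exact le_of_mul_le_mul_right h h0

theorem map_star (p : CStarSeminorm A) (a : A) : p (star a) = p a :=
  le_antisymm (by simpa using p.le_map_star (star a)) (p.le_map_star a)

theorem map_one_le (p : CStarSeminorm A) : p 1 ≤ 1 := by
  have h := p.map_star_mul_self 1
  rw [star_one, one_mul] at h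
  by_contra! hc
  nlinarith

/-- The pointwise supremum of a pointwise bounded set of C*-seminorms. -/
noncomputable def sup (S : Set (CStarSeminorm A))
    (hS : ∀ a : A, BddAbove {t : ℝ | ∃ p ∈ S, p a = t}) : CStarSeminorm A where
  toFun a := sSup {t : ℝ | ∃ p ∈ S, p a = t}
  map_zero' := by
    refine le_antisymm (Real.sSup_le ?_ le_rfl) (Real.sSup_nonneg ?_)
    · rintro _ ⟨p, -, rfl⟩; exact (map_zero p.toSeminorm).le
    · rintro _ ⟨p, -, rfl⟩; exact p.nonneg _
  add_le' a b := by
    refine Real.sSup_le ?_ (add_nonneg (Real.sSup_nonneg ?_) (Real.sSup_nonneg ?_))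
    · rintro _ ⟨p, hp, rfl⟩
      exact (map_add_le_add p.toSeminorm a b).trans
        (add_le_add (le_csSup (hS a) ⟨p, hp, rfl⟩) (le_csSup (hS b) ⟨p, hp, rfl⟩))
    · rintro _ ⟨p, -, rfl⟩; exact p.nonneg _
    · rintro _ ⟨p, -, rfl⟩; exact p.nonneg _
  neg' a := by
    congr 1; ext t
    refine exists_congr fun p => and_congr_right fun _ => ?_
    rw [map_neg_eq_map p.toSeminorm a]
  smul' c a := by
    have h : ∀ x : A, sSup {t : ℝ | ∃ p ∈ S, p x = t} = ⨆ p : S, (p : CStarSeminorm A) x := by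
      intro x
      rw [iSup]
      congr 1; ext t; simp
    rw [h, h, Real.mul_iSup_of_nonneg (norm_nonneg c)]
    exact congrArg iSup (funext fun p => map_smul_eq_mul (p : CStarSeminorm A).toSeminorm c a)
  mul_le' a b := by
    have h0 : ∀ x : A, 0 ≤ sSup {t : ℝ | ∃ p ∈ S, p x = t} := fun x => Real.sSup_nonneg (by
      rintro _ ⟨p, -, rfl⟩; exact p.nonneg _)
    refine Real.sSup_le ?_ (mul_nonneg (h0 a) (h0 b))
    rintro _ ⟨p, hp, rfl⟩
    exact (p.map_mul_le a b).trans (mul_le_mul (le_csSup (hS a) ⟨p, hp, rfl⟩)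
      (le_csSup (hS b) ⟨p, hp, rfl⟩) (p.nonneg b) (h0 a))
  star_mul_self' a := by
    have h0 : ∀ x : A, 0 ≤ sSup {t : ℝ | ∃ p ∈ S, p x = t} := fun x => Real.sSup_nonneg (by
      rintro _ ⟨p, -, rfl⟩; exact p.nonneg _)
    refine le_antisymm (Real.sSup_le ?_ (sq_nonneg _)) ?_
    · rintro _ ⟨p, hp, rfl⟩
      rw [p.map_star_mul_self]
      exact pow_le_pow_left₀ (p.nonneg a) (le_csSup (hS a) ⟨p, hp, rfl⟩) 2
    · refine (Real.le_sqrt (h0 a) (h0 _)).1 (Real.sSup_le ?_ (Real.sqrt_nonneg _))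
      rintro _ ⟨p, hp, rfl⟩
      refine Real.le_sqrt_of_sq_le ?_
      rw [← p.map_star_mul_self]
      exact le_csSup (hS _) ⟨p, hp, rfl⟩

theorem le_sup {S : Set (CStarSeminorm A)}
    (hS : ∀ a : A, BddAbove {t : ℝ | ∃ p ∈ S, p a = t}) {p : CStarSeminorm A} (hp : p ∈ S)
    (a : A) : p a ≤ sup S hS a :=
  le_csSup (hS a) ⟨p, hp, rfl⟩

theorem sup_le {S : Set (CStarSeminorm A)}
    (hS : ∀ a : A, BddAbove {t : ℝ | ∃ p ∈ S, p a = t}) {a : A} {C : ℝ} (hC : 0 ≤ C)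
    (h : ∀ p ∈ S, p a ≤ C) : sup S hS a ≤ C :=
  Real.sSup_le (by rintro _ ⟨p, hp, rfl⟩; exact h p hp) hC

end Basic

section Completion

variable {A : Type u} [Ring A] [StarRing A] [Algebra ℂ A]

/-- A copy of `A`, carrying the topology of the seminorm `p`. -/
def Carrier (_p : CStarSeminorm A) : Type u := A

variable (p : CStarSeminorm A)

instance : Ring p.Carrier := inferInstanceAs (Ring A)
instance : StarRing p.Carrier := inferInstanceAs (StarRing A)
instance : Algebra ℂ p.Carrier := inferInstanceAs (Algebra ℂ A)

noncomputable instance : SeminormedRing p.Carrier :=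
  { (inferInstance : Ring p.Carrier),
    (p.toSeminorm.toAddGroupSeminorm.toSeminormedAddCommGroup : SeminormedAddCommGroup A) with
    norm_mul_le := p.map_mul_le }

noncomputable instance : NormedAlgebra ℂ p.Carrier where
  norm_smul_le c a := (map_smul_eq_mul p.toSeminorm c a).le

instance : NormedStarGroup p.Carrier where
  norm_star_le a := (p.map_star a).le

/-- The C*-algebra obtained from `A` by dividing out the kernel of `p` and completing. -/
abbrev Completion : Type u := UniformSpace.Completion p.Carrier

noncomputable instance : NormedAlgebra ℂ p.Completion where
  norm_smul_le := norm_smul_le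

/-- The canonical map of `A` into the completion. -/
noncomputable def ofFun (a : A) : p.Completion :=
  UniformSpace.Completion.coe' (α := p.Carrier) a

theorem norm_ofFun (a : A) : ‖p.ofFun a‖ = p a :=
  UniformSpace.Completion.norm_coe (E := p.Carrier) a

theorem induction_on {P : p.Completion → Prop} (x : p.Completion)
    (hc : IsClosed {x | P x}) (h : ∀ a : A, P (p.ofFun a)) : P x :=
  UniformSpace.Completion.induction_on (α := p.Carrier) x hc h

theorem denseRange_ofFun : DenseRange p.ofFun :=
  UniformSpace.Completion.denseRange_coe (α := p.Carrier)

theorem ofFun_add (a b : A) : p.ofFun (a + b) = p.ofFun a + p.ofFun b :=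
  UniformSpace.Completion.coe_add (α := p.Carrier) a b

theorem ofFun_mul (a b : A) : p.ofFun (a * b) = p.ofFun a * p.ofFun b :=
  UniformSpace.Completion.coe_mul (α := p.Carrier) a b

theorem ofFun_algebraMap (c : ℂ) : p.ofFun (algebraMap ℂ A c) = algebraMap ℂ p.Completion c :=
  rfl

theorem ofFun_smul (c : ℂ) (a : A) : p.ofFun (c • a) = c • p.ofFun a := by
  rw [Algebra.smul_def, Algebra.smul_def, ofFun_mul, ofFun_algebraMap]

theorem uniformContinuous_star : UniformContinuous (star : p.Carrier → p.Carrier) :=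
  (starNormedAddGroupHom (E := p.Carrier)).uniformContinuous

noncomputable instance : Star p.Completion where
  star := UniformSpace.Completion.map (star : p.Carrier → p.Carrier)

theorem ofFun_star (a : A) : p.ofFun (star a) = star (p.ofFun a) :=
  (UniformSpace.Completion.map_coe p.uniformContinuous_star a).symm

instance : ContinuousStar p.Completion where
  continuous_star := UniformSpace.Completion.continuous_map

noncomputable instance : StarRing p.Completion where
  star_involutive x := by
    induction' x using p.induction_on with a
    · exact isClosed_eq (by fun_prop) (by fun_prop)
    rw [← ofFun_star, ← ofFun_star, star_star]
  star_mul x y := by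
    induction' x using p.induction_on with a
    · exact isClosed_eq (by fun_prop) (by fun_prop)
    induction' y using p.induction_on with b
    · exact isClosed_eq (by fun_prop) (by fun_prop)
    rw [← ofFun_mul, ← ofFun_star, star_mul, ofFun_mul, ofFun_star, ofFun_star]
  star_add x y := by
    induction' x using p.induction_on with a
    · exact isClosed_eq (by fun_prop) (by fun_prop)
    induction' y using p.induction_on with b
    · exact isClosed_eq (by fun_prop) (by fun_prop)
    rw [← ofFun_add, ← ofFun_star, star_add, ofFun_add, ofFun_star, ofFun_star]

/-- The canonical map of `A` into the completion, as a *-homomorphism. -/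
noncomputable def of : A →⋆ₐ[ℂ] p.Completion where
  toFun := p.ofFun
  map_one' := rfl
  map_mul' := p.ofFun_mul
  map_zero' := rfl
  map_add' := p.ofFun_add
  commutes' := p.ofFun_algebraMap
  map_star' := p.ofFun_star

theorem norm_of (a : A) : ‖p.of a‖ = p a := p.norm_ofFun a

theorem denseRange_of : DenseRange p.of := p.denseRange_ofFun

theorem star_smul' [StarModule ℂ A] (c : ℂ) (x : p.Completion) :
    star (c • x) = star c • star x := by
  rw [Algebra.smul_def, star_mul, ← ofFun_algebraMap, ← ofFun_star, ← algebraMap_star_comm,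
    ofFun_algebraMap, ← Algebra.commutes, ← Algebra.smul_def]

noncomputable instance [StarModule ℂ A] : CStarAlgebra p.Completion where
  norm_mul_self_le x := by
    induction' x using p.induction_on with a
    · exact isClosed_le (by fun_prop) (by fun_prop)
    rw [← ofFun_star, ← ofFun_mul, norm_ofFun, norm_ofFun, p.map_star_mul_self, sq]
  star_smul := p.star_smul'

variable {B : Type*} [CStarAlgebra B]

theorem uniformContinuous_of_bound (f : A →⋆ₐ[ℂ] B) (hf : ∀ a, ‖f a‖ ≤ p a) :
    UniformContinuous (fun a : p.Carrier => (f : A → B) a) := by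
  let g : p.Carrier →+* B := (f : A →+* B)
  have hg : Continuous g := AddMonoidHomClass.continuous_of_bound g 1 fun a => by
    rw [one_mul]; exact hf a
  exact uniformContinuous_addMonoidHom_of_continuous (f := g) hg

/-- Extension of a *-homomorphism bounded by `p` to the completion. -/
noncomputable def lift (f : A →⋆ₐ[ℂ] B) (hf : ∀ a, ‖f a‖ ≤ p a) : p.Completion →⋆ₐ[ℂ] B :=
  let F : p.Completion → B := UniformSpace.Completion.extension
    (fun a : p.Carrier => (f : A → B) a)
  have hF : ∀ a, F (p.ofFun a) = f a :=
    fun a => UniformSpace.Completion.extension_coe (p.uniformContinuous_of_bound f hf) a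
  have hc : Continuous F := UniformSpace.Completion.continuous_extension
  { toFun := F
    map_one' := (hF 1).trans (map_one f)
    map_zero' := (hF 0).trans (map_zero f)
    map_mul' := fun x y => by
      induction' x using p.induction_on with a
      · exact isClosed_eq (by fun_prop) (by fun_prop)
      induction' y using p.induction_on with b
      · exact isClosed_eq (by fun_prop) (by fun_prop)
      rw [← ofFun_mul, hF, hF, hF, map_mul]
    map_add' := fun x y => by
      induction' x using p.induction_on with a
      · exact isClosed_eq (by fun_prop) (by fun_prop)
      induction' y using p.induction_on with b
      · exact isClosed_eq (by fun_prop) (by fun_prop)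
      rw [← ofFun_add, hF, hF, hF, map_add]
    commutes' := fun c => by
      rw [← ofFun_algebraMap, hF]; exact AlgHomClass.commutes f c
    map_star' := fun x => by
      induction' x using p.induction_on with a
      · exact isClosed_eq (by fun_prop) (by fun_prop)
      rw [← ofFun_star, hF, hF]; exact StarHomClass.map_star f a }

theorem lift_of (f : A →⋆ₐ[ℂ] B) (hf : ∀ a, ‖f a‖ ≤ p a) (a : A) :
    p.lift f hf (p.of a) = f a :=
  UniformSpace.Completion.extension_coe (p.uniformContinuous_of_bound f hf) a

end Completion

/-- The C*-seminorm `a ↦ ‖f a‖` of a *-homomorphism `f` into a C*-algebra. -/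
noncomputable def ofHom {A : Type u} [Ring A] [StarRing A] [Algebra ℂ A] {B : Type*}
    [CStarAlgebra B] (f : A →⋆ₐ[ℂ] B) : CStarSeminorm A where
  toFun a := ‖f a‖
  map_zero' := by simp
  add_le' a b := by simpa using norm_add_le (f a) (f b)
  neg' a := by simp
  smul' c a := by simp [norm_smul]
  mul_le' a b := by simpa using norm_mul_le (f a) (f b)
  star_mul_self' a := by
    rw [map_mul, StarHomClass.map_star, CStarRing.norm_star_mul_self, sq]

end CStarSeminorm

/-! ### Universal C*-algebras generated by projections -/

/-- The free complex unital *-algebra on a set `X` of self-adjoint generators: noncommutative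
polynomials in the variables `x ∈ X`, the involution being conjugate linear and fixing the
variables. -/
def FreeStarAlgebra (X : Type u) : Type u := FreeAlgebra ℂ X

namespace FreeStarAlgebra

variable {X : Type u}

instance : Ring (FreeStarAlgebra X) := inferInstanceAs (Ring (FreeAlgebra ℂ X))
instance : Algebra ℂ (FreeStarAlgebra X) := inferInstanceAs (Algebra ℂ (FreeAlgebra ℂ X))

/-- The generators. -/
def ι (x : X) : FreeStarAlgebra X := FreeAlgebra.ι ℂ x

/-- The opposite ring of the free algebra, with the conjugate scalar multiplication. -/
def Conj (X : Type u) : Type u := (FreeStarAlgebra X)ᵐᵒᵖ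

noncomputable instance : Ring (Conj X) := inferInstanceAs (Ring (FreeStarAlgebra X)ᵐᵒᵖ)

noncomputable instance : Algebra ℂ (Conj X) :=
  Algebra.compHom (FreeStarAlgebra X)ᵐᵒᵖ (starRingEnd ℂ)

/-- The conjugate-linear anti-automorphism fixing the generators, as an algebra homomorphism. -/
noncomputable def starAux : FreeAlgebra ℂ X →ₐ[ℂ] Conj X :=
  FreeAlgebra.lift ℂ (fun x => (MulOpposite.op (ι x) : Conj X))

theorem starAux_ι (x : X) : starAux (ι x) = (MulOpposite.op (ι x) : Conj X) :=
  FreeAlgebra.lift_ι_apply (R := ℂ) (A := Conj X) _ x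

noncomputable instance : Star (FreeStarAlgebra X) where
  star a := MulOpposite.unop (starAux a : (FreeStarAlgebra X)ᵐᵒᵖ)

@[simp]
theorem star_ι (x : X) : star (ι x : FreeStarAlgebra X) = ι x :=
  congrArg MulOpposite.unop (starAux_ι x)

theorem star_algebraMap' (c : ℂ) :
    star (algebraMap ℂ (FreeStarAlgebra X) c) = algebraMap ℂ (FreeStarAlgebra X) (star c) :=
  congrArg MulOpposite.unop (AlgHom.commutes starAux c)

theorem star_mul' (a b : FreeStarAlgebra X) : star (a * b) = star b * star a :=
  congrArg MulOpposite.unop (map_mul starAux a b)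

theorem star_add' (a b : FreeStarAlgebra X) : star (a + b) = star a + star b :=
  congrArg MulOpposite.unop (map_add starAux a b)

theorem induction {P : FreeStarAlgebra X → Prop}
    (algebraMap : ∀ c : ℂ, P (algebraMap ℂ (FreeStarAlgebra X) c)) (ι : ∀ x, P (ι x))
    (mul : ∀ a b, P a → P b → P (a * b)) (add : ∀ a b, P a → P b → P (a + b))
    (a : FreeStarAlgebra X) : P a :=
  FreeAlgebra.induction ℂ X (motive := P) algebraMap ι mul add a

noncomputable instance : StarRing (FreeStarAlgebra X) where
  star_involutive a := by
    induction a using FreeStarAlgebra.induction with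
    | algebraMap c => rw [star_algebraMap', star_algebraMap', star_star]
    | ι x => rw [star_ι, star_ι]
    | mul a b ha hb => rw [star_mul', star_mul', ha, hb]
    | add a b ha hb => rw [star_add', star_add', ha, hb]
  star_mul := star_mul'
  star_add := star_add'

instance : StarModule ℂ (FreeStarAlgebra X) where
  star_smul c a := by
    rw [Algebra.smul_def, star_mul, star_algebraMap', ← Algebra.commutes, ← Algebra.smul_def]

variable {B : Type*} [CStarAlgebra B]

/-- Evaluation of noncommutative polynomials at self-adjoint elements of a C*-algebra. -/
noncomputable def eval (b : X → B) (hb : ∀ x, star (b x) = b x) : FreeStarAlgebra X →⋆ₐ[ℂ] B :=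
  let F : FreeStarAlgebra X →ₐ[ℂ] B := FreeAlgebra.lift ℂ b
  have hF : ∀ x, F (ι x) = b x := FreeAlgebra.lift_ι_apply b
  { F with
    map_star' := fun a => by
      change F (star a) = star (F a)
      induction a using FreeStarAlgebra.induction with
      | algebraMap c => rw [star_algebraMap', AlgHom.commutes, AlgHom.commutes,
          algebraMap_star_comm]
      | ι x => rw [star_ι, hF, hb]
      | mul a b ha hb => rw [star_mul, map_mul, map_mul, ha, hb, star_mul]
      | add a b ha hb => rw [star_add, map_add, map_add, ha, hb, star_add] }

@[simp]
theorem eval_ι (b : X → B) (hb : ∀ x, star (b x) = b x) (x : X) : eval b hb (ι x) = b x :=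
  FreeAlgebra.lift_ι_apply b x

end FreeStarAlgebra

section Universal

variable {X : Type u}

open FreeStarAlgebra

theorem universal_bddAbove (R : Set (FreeStarAlgebra X)) (hR : ∀ x, ι x * ι x - ι x ∈ R)
    (a : FreeStarAlgebra X) :
    BddAbove {t : ℝ | ∃ p ∈ {p : CStarSeminorm (FreeStarAlgebra X) | ∀ r ∈ R, p r = 0},
      p a = t} := by
  suffices h : ∃ C : ℝ, 0 ≤ C ∧ ∀ p : CStarSeminorm (FreeStarAlgebra X),
      (∀ r ∈ R, p r = 0) → p a ≤ C by
    obtain ⟨C, -, hC⟩ := h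
    exact ⟨C, by rintro _ ⟨p, hp, rfl⟩; exact hC p hp⟩
  induction a using FreeStarAlgebra.induction with
  | algebraMap c =>
    refine ⟨‖c‖, norm_nonneg c, fun p _ => ?_⟩
    rw [Algebra.algebraMap_eq_smul_one, map_smul_eq_mul]
    exact mul_le_of_le_one_right (norm_nonneg c) p.map_one_le
  | ι x =>
    refine ⟨1, zero_le_one, fun p hp => ?_⟩
    have h1 : p (ι x * ι x) = p (ι x) ^ 2 := by
      have := p.map_star_mul_self (ι x)
      rwa [star_ι] at this
    have h2 : p (ι x * ι x) = p (ι x) := by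
      refine le_antisymm ?_ ?_
      · have := map_add_le_add p.toSeminorm (ι x * ι x - ι x) (ι x)
        rwa [sub_add_cancel, hp _ (hR x), zero_add] at this
      · have := map_sub_le_add p.toSeminorm (ι x * ι x) (ι x * ι x - ι x)
        rwa [sub_sub_cancel, hp _ (hR x), add_zero] at this
    by_contra! hc
    nlinarith
  | mul a b ha hb =>
    obtain ⟨C, hC0, hC⟩ := ha
    obtain ⟨D, hD0, hD⟩ := hb
    exact ⟨C * D, mul_nonneg hC0 hD0, fun p hp => (p.map_mul_le a b).trans
      (mul_le_mul (hC p hp) (hD p hp) (p.nonneg b) hC0)⟩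
  | add a b ha hb =>
    obtain ⟨C, hC0, hC⟩ := ha
    obtain ⟨D, hD0, hD⟩ := hb
    exact ⟨C + D, add_nonneg hC0 hD0, fun p hp => (map_add_le_add p.toSeminorm a b).trans
      (add_le_add (hC p hp) (hD p hp))⟩

/-- The largest C*-seminorm on the free *-algebra that vanishes on the relations `R`. -/
noncomputable def universalSeminorm (R : Set (FreeStarAlgebra X))
    (hR : ∀ x, ι x * ι x - ι x ∈ R) : CStarSeminorm (FreeStarAlgebra X) :=
  CStarSeminorm.sup {p | ∀ r ∈ R, p r = 0} (universal_bddAbove R hR)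

/-- The universal C*-algebra with generators `X` and relations `x = x* = x²` for `x ∈ X` and
`r = 0` for `r ∈ R` (where the relations `x² = x` belong to `R`). -/
def UniversalCStar (R : Set (FreeStarAlgebra X)) (hR : ∀ x, ι x * ι x - ι x ∈ R) : Type u :=
  (universalSeminorm R hR).Completion

namespace UniversalCStar

variable (R : Set (FreeStarAlgebra X)) (hR : ∀ x, ι x * ι x - ι x ∈ R)

noncomputable instance : CStarAlgebra (UniversalCStar R hR) :=
  inferInstanceAs (CStarAlgebra (universalSeminorm R hR).Completion)

/-- The canonical *-homomorphism from the free *-algebra. -/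
noncomputable def mk : FreeStarAlgebra X →⋆ₐ[ℂ] UniversalCStar R hR :=
  (universalSeminorm R hR).of

theorem denseRange_mk : DenseRange (mk R hR) := (universalSeminorm R hR).denseRange_of

theorem mk_eq_zero {r : FreeStarAlgebra X} (hr : r ∈ R) : mk R hR r = 0 := by
  refine norm_eq_zero.1 (((universalSeminorm R hR).norm_of r).trans (le_antisymm ?_ ?_))
  · exact CStarSeminorm.sup_le _ le_rfl fun p hp => (hp r hr).le
  · exact CStarSeminorm.nonneg _ r

/-- The universal property: a family of self-adjoint elements of a C*-algebra that satisfies the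
relations is the image of the generators under a *-homomorphism. -/
noncomputable def lift {B : Type*} [CStarAlgebra B] (b : X → B) (hb : ∀ x, star (b x) = b x)
    (hr : ∀ r ∈ R, eval b hb r = 0) : UniversalCStar R hR →⋆ₐ[ℂ] B :=
  (universalSeminorm R hR).lift (eval b hb) fun a =>
    CStarSeminorm.le_sup (universal_bddAbove R hR) (p := CStarSeminorm.ofHom (eval b hb))
      (fun r hrR => show ‖eval b hb r‖ = 0 by rw [hr r hrR, norm_zero]) a

theorem lift_mk {B : Type*} [CStarAlgebra B] (b : X → B) (hb : ∀ x, star (b x) = b x)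
    (hr : ∀ r ∈ R, eval b hb r = 0) (a : FreeStarAlgebra X) :
    lift R hR b hb hr (mk R hR a) = eval b hb a :=
  (universalSeminorm R hR).lift_of _ _ a

theorem adjoin_generators :
    (StarAlgebra.adjoin ℂ (Set.range fun x => mk R hR (ι x))).topologicalClosure = ⊤ := by
  rw [← top_le_iff]
  intro y _
  have hsub : Set.range (mk R hR) ⊆
      (StarAlgebra.adjoin ℂ (Set.range fun x => mk R hR (ι x)) :
        StarSubalgebra ℂ (UniversalCStar R hR)) := by
    rintro _ ⟨a, rfl⟩
    induction a using FreeStarAlgebra.induction with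
    | algebraMap c => rw [AlgHomClass.commutes]; exact algebraMap_mem _ c
    | ι x => exact StarAlgebra.subset_adjoin ℂ _ ⟨x, rfl⟩
    | mul a b ha hb => rw [map_mul]; exact mul_mem ha hb
    | add a b ha hb => rw [map_add]; exact add_mem ha hb
  exact closure_mono hsub (denseRange_mk R hR y)

end UniversalCStar

end Universal

/-! ### The minimal tensor product -/

section MinTensor

open scoped TensorProduct InnerProductSpace

/-- The C*-seminorm `x ↦ ‖T x‖` of a *-representation `T` by bounded operators on an inner product
space. -/
noncomputable def CStarSeminorm.ofRep {A₀ : Type u} [Ring A₀] [StarRing A₀] [Algebra ℂ A₀]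
    {E : Type*} [NormedAddCommGroup E] [InnerProductSpace ℂ E] (T : A₀ →ₐ[ℂ] (E →L[ℂ] E))
    (hT : ∀ (x : A₀) (ξ η : E), ⟪T (star x) ξ, η⟫_ℂ = ⟪ξ, T x η⟫_ℂ) : CStarSeminorm A₀ where
  toFun x := ‖T x‖
  map_zero' := by simp
  add_le' a b := by simpa using norm_add_le (T a) (T b)
  neg' a := by simp
  smul' c a := by simp [norm_smul]
  mul_le' a b := by simpa using norm_mul_le (T a) (T b)
  star_mul_self' x := by
    have key : ∀ x, ‖T x‖ ^ 2 ≤ ‖T (star x * x)‖ := by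
      intro x
      refine (Real.le_sqrt (norm_nonneg _) (norm_nonneg _)).1 ?_
      refine ContinuousLinearMap.opNorm_le_bound _ (Real.sqrt_nonneg _) fun ξ => ?_
      refine le_of_sq_le_sq ?_ (by positivity)
      rw [mul_pow, Real.sq_sqrt (norm_nonneg _), ← inner_self_eq_norm_sq (𝕜 := ℂ),
        ← hT, ← mul_apply_eq_comp, ← map_mul, sq, ← mul_assoc]
      refine (RCLike.re_le_norm _).trans ((norm_inner_le_norm _ _).trans ?_)
      exact mul_le_mul_of_nonneg_right (ContinuousLinearMap.le_opNorm _ _) (norm_nonneg _)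
    have hle : ∀ x, ‖T x‖ ≤ ‖T (star x)‖ := by
      intro x
      have h := key x
      rw [map_mul, sq] at h
      rcases (norm_nonneg (T x)).eq_or_lt with h0 | h0
      · rw [← h0]; exact norm_nonneg _
      · exact le_of_mul_le_mul_right (h.trans (norm_mul_le _ _)) h0
    refine le_antisymm ?_ (key x)
    rw [map_mul, sq]
    refine (norm_mul_le _ _).trans (mul_le_mul_of_nonneg_right ?_ (norm_nonneg _))
    simpa using hle (star x)

variable {A B : Type u} [CStarAlgebra A] [CStarAlgebra B]

/-- The tensor product of two representations on Hilbert spaces, acting on the algebraic tensor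
product `H ⊗ K` with its inner product. -/
noncomputable def tensorRep {H K : Type u} [NormedAddCommGroup H] [InnerProductSpace ℂ H]
    [CompleteSpace H] [NormedAddCommGroup K] [InnerProductSpace ℂ K] [CompleteSpace K]
    (π : A →⋆ₐ[ℂ] (H →L[ℂ] H)) (ρ : B →⋆ₐ[ℂ] (K →L[ℂ] K)) :
    A ⊗[ℂ] B →ₐ[ℂ] (H ⊗[ℂ] K →L[ℂ] H ⊗[ℂ] K) :=
  Algebra.TensorProduct.algHomOfLinearMapTensorProduct
    (TensorProduct.lift (LinearMap.mk₂ ℂ (fun a b => TensorProduct.mapL (π a) (ρ b))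
      (fun a a' b => by rw [map_add, TensorProduct.mapL_add_left])
      (fun c a b => by rw [map_smul, TensorProduct.mapL_smul_left])
      (fun a b b' => by rw [map_add, TensorProduct.mapL_add_right])
      (fun c a b => by rw [map_smul, TensorProduct.mapL_smul_right])))
    (fun a a' b b' => by
      simp only [TensorProduct.lift.tmul, LinearMap.mk₂_apply, map_mul]
      exact TensorProduct.mapL_mul _ _ _ _)
    (by
      simp only [TensorProduct.lift.tmul, LinearMap.mk₂_apply,
        map_one]
      exact TensorProduct.mapL_id_id)

theorem tensorRep_tmul {H K : Type u} [NormedAddCommGroup H] [InnerProductSpace ℂ H]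
    [CompleteSpace H] [NormedAddCommGroup K] [InnerProductSpace ℂ K] [CompleteSpace K]
    (π : A →⋆ₐ[ℂ] (H →L[ℂ] H)) (ρ : B →⋆ₐ[ℂ] (K →L[ℂ] K)) (a : A) (b : B) :
    tensorRep π ρ (a ⊗ₜ b) = TensorProduct.mapL (π a) (ρ b) := rfl

theorem inner_tensorRep {H K : Type u} [NormedAddCommGroup H] [InnerProductSpace ℂ H]
    [CompleteSpace H] [NormedAddCommGroup K] [InnerProductSpace ℂ K] [CompleteSpace K]
    (π : A →⋆ₐ[ℂ] (H →L[ℂ] H)) (ρ : B →⋆ₐ[ℂ] (K →L[ℂ] K)) (x : A ⊗[ℂ] B) (ξ η : H ⊗[ℂ] K) :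
    ⟪tensorRep π ρ (star x) ξ, η⟫_ℂ = ⟪ξ, tensorRep π ρ x η⟫_ℂ := by
  induction x with
  | zero => simp
  | add x y hx hy => simp [inner_add_left, inner_add_right, hx, hy]
  | tmul a b =>
    rw [TensorProduct.star_tmul, tensorRep_tmul, tensorRep_tmul]
    induction ξ with
    | zero => simp
    | add x y hx hy => simp only [map_add, inner_add_left, hx, hy]
    | tmul h k =>
      induction η with
      | zero => simp
      | add x y hx hy => simp only [map_add, inner_add_right, hx, hy]
      | tmul h' k' =>
        simp only [TensorProduct.mapL_tmul, TensorProduct.inner_tmul]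
        rw [StarHomClass.map_star π, StarHomClass.map_star ρ, ContinuousLinearMap.star_eq_adjoint,
          ContinuousLinearMap.star_eq_adjoint, ContinuousLinearMap.adjoint_inner_left,
          ContinuousLinearMap.adjoint_inner_left]

/-- The C*-seminorm on the algebraic tensor product given by a pair of representations. -/
noncomputable def spatialSeminorm {H K : Type u} [NormedAddCommGroup H] [InnerProductSpace ℂ H]
    [CompleteSpace H] [NormedAddCommGroup K] [InnerProductSpace ℂ K] [CompleteSpace K]
    (π : A →⋆ₐ[ℂ] (H →L[ℂ] H)) (ρ : B →⋆ₐ[ℂ] (K →L[ℂ] K)) : CStarSeminorm (A ⊗[ℂ] B) :=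
  CStarSeminorm.ofRep (tensorRep π ρ) (inner_tensorRep π ρ)

variable (A B) in
/-- The C*-seminorms on `A ⊗ B` given by pairs of representations on Hilbert spaces. -/
def spatialSeminorms : Set (CStarSeminorm (A ⊗[ℂ] B)) :=
  {p | ∃ (H K : Type u) (_ : NormedAddCommGroup H) (_ : InnerProductSpace ℂ H)
    (_ : CompleteSpace H) (_ : NormedAddCommGroup K) (_ : InnerProductSpace ℂ K)
    (_ : CompleteSpace K) (π : A →⋆ₐ[ℂ] (H →L[ℂ] H)) (ρ : B →⋆ₐ[ℂ] (K →L[ℂ] K)),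
    p = spatialSeminorm π ρ}

theorem spatial_bddAbove (x : A ⊗[ℂ] B) :
    BddAbove {t : ℝ | ∃ p ∈ spatialSeminorms A B, p x = t} := by
  suffices h : ∃ C : ℝ, ∀ p ∈ spatialSeminorms A B, p x ≤ C by
    obtain ⟨C, hC⟩ := h
    exact ⟨C, by rintro _ ⟨p, hp, rfl⟩; exact hC p hp⟩
  induction x with
  | zero => exact ⟨0, fun p _ => (map_zero p.toSeminorm).le⟩
  | add x y hx hy =>
    obtain ⟨C, hC⟩ := hx
    obtain ⟨D, hD⟩ := hy
    exact ⟨C + D, fun p hp => (map_add_le_add p.toSeminorm x y).trans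
      (add_le_add (hC p hp) (hD p hp))⟩
  | tmul a b =>
    refine ⟨‖a‖ * ‖b‖, ?_⟩
    rintro _ ⟨H, K, _, _, _, _, _, _, π, ρ, rfl⟩
    exact (TensorProduct.norm_mapL_le (π a) (ρ b)).trans (mul_le_mul
      (NonUnitalStarAlgHom.norm_apply_le π a) (NonUnitalStarAlgHom.norm_apply_le ρ b)
      (norm_nonneg _) (norm_nonneg _))

variable (A B) in
/-- The minimal (spatial) C*-norm on `A ⊗ B`: the supremum of `‖(π ⊗ ρ)(x)‖` over all
representations `π` of `A` and `ρ` of `B` on Hilbert spaces. -/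
noncomputable def minSeminorm : CStarSeminorm (A ⊗[ℂ] B) :=
  CStarSeminorm.sup (spatialSeminorms A B) spatial_bddAbove

variable (A B) in
/-- The minimal tensor product of two C*-algebras. -/
def MinTensor : Type u := (minSeminorm A B).Completion

namespace MinTensor

noncomputable instance : CStarAlgebra (MinTensor A B) :=
  inferInstanceAs (CStarAlgebra (minSeminorm A B).Completion)

variable (A B) in
/-- The canonical *-homomorphism from the algebraic tensor product. -/
noncomputable def of : A ⊗[ℂ] B →⋆ₐ[ℂ] MinTensor A B := (minSeminorm A B).of

theorem denseRange_of : DenseRange (of A B) := (minSeminorm A B).denseRange_of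

/-- The elementary tensor `a ⊗ b` in the minimal tensor product. -/
noncomputable def tmul (a : A) (b : B) : MinTensor A B := of A B (a ⊗ₜ[ℂ] b)

theorem tmul_mul_tmul (a a' : A) (b b' : B) :
    tmul a b * tmul a' b' = tmul (a * a') (b * b') := by
  rw [tmul, tmul, ← map_mul, Algebra.TensorProduct.tmul_mul_tmul]; rfl

theorem star_tmul (a : A) (b : B) : star (tmul a b) = tmul (star a) (star b) := by
  rw [tmul, ← StarHomClass.map_star, TensorProduct.star_tmul]; rfl

theorem one_tmul_one : tmul (1 : A) (1 : B) = 1 := map_one (of A B)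

theorem zero_tmul (b : B) : tmul (0 : A) b = 0 := by
  rw [tmul, TensorProduct.zero_tmul, map_zero]

theorem tmul_zero (a : A) : tmul a (0 : B) = 0 := by
  rw [tmul, TensorProduct.tmul_zero, map_zero]

theorem sum_tmul {n : Type*} (s : Finset n) (f : n → A) (b : B) :
    tmul (∑ k ∈ s, f k) b = ∑ k ∈ s, tmul (f k) b := by
  simp only [tmul, TensorProduct.sum_tmul, map_sum]

theorem tmul_sum {n : Type*} (s : Finset n) (a : A) (f : n → B) :
    tmul a (∑ k ∈ s, f k) = ∑ k ∈ s, tmul a (f k) := by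
  simp only [tmul, TensorProduct.tmul_sum, map_sum]

variable {A' B' : Type u} [CStarAlgebra A'] [CStarAlgebra B']

/-- The tensor product of two *-homomorphisms on the algebraic tensor product. -/
noncomputable def algMap (φ : A →⋆ₐ[ℂ] A') (ψ : B →⋆ₐ[ℂ] B') : A ⊗[ℂ] B →⋆ₐ[ℂ] A' ⊗[ℂ] B' :=
  { Algebra.TensorProduct.map (φ : A →ₐ[ℂ] A') (ψ : B →ₐ[ℂ] B') with
    map_star' := fun x => by
      change Algebra.TensorProduct.map (φ : A →ₐ[ℂ] A') (ψ : B →ₐ[ℂ] B') (star x) =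
        star (Algebra.TensorProduct.map (φ : A →ₐ[ℂ] A') (ψ : B →ₐ[ℂ] B') x)
      induction x with
      | zero => simp
      | add x y hx hy => rw [star_add, map_add, map_add, hx, hy, star_add]
      | tmul a b =>
        simp only [TensorProduct.star_tmul, Algebra.TensorProduct.map_tmul]
        congr 1
        · exact StarHomClass.map_star φ a
        · exact StarHomClass.map_star ψ b }

theorem algMap_tmul (φ : A →⋆ₐ[ℂ] A') (ψ : B →⋆ₐ[ℂ] B') (a : A) (b : B) :
    algMap φ ψ (a ⊗ₜ[ℂ] b) = φ a ⊗ₜ[ℂ] ψ b := rfl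

theorem norm_of_algMap_le (φ : A →⋆ₐ[ℂ] A') (ψ : B →⋆ₐ[ℂ] B') (x : A ⊗[ℂ] B) :
    ‖of A' B' (algMap φ ψ x)‖ ≤ minSeminorm A B x := by
  refine ((minSeminorm A' B').norm_of _).le.trans ?_
  refine CStarSeminorm.sup_le _ (CStarSeminorm.nonneg _ x) ?_
  rintro _ ⟨H, K, _, _, _, _, _, _, π, ρ, rfl⟩
  have h : ∀ y : A ⊗[ℂ] B, tensorRep π ρ (algMap φ ψ y) =
      tensorRep (π.comp φ) (ρ.comp ψ) y := by
    intro y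
    induction y with
    | zero => simp
    | add x y hx hy => simp only [map_add, hx, hy]
    | tmul a b => rfl
  calc spatialSeminorm π ρ (algMap φ ψ x) = spatialSeminorm (π.comp φ) (ρ.comp ψ) x :=
        congrArg norm (h x)
    _ ≤ minSeminorm A B x :=
        CStarSeminorm.le_sup spatial_bddAbove
          ⟨H, K, _, _, _, _, _, _, π.comp φ, ρ.comp ψ, rfl⟩ x

/-- The tensor product `φ ⊗ ψ` of two *-homomorphisms. -/
noncomputable def map (φ : A →⋆ₐ[ℂ] A') (ψ : B →⋆ₐ[ℂ] B') : MinTensor A B →⋆ₐ[ℂ] MinTensor A' B' :=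
  (minSeminorm A B).lift ((of A' B').comp (algMap φ ψ)) (norm_of_algMap_le φ ψ)

theorem map_tmul (φ : A →⋆ₐ[ℂ] A') (ψ : B →⋆ₐ[ℂ] B') (a : A) (b : B) :
    map φ ψ (tmul a b) = tmul (φ a) (ψ b) :=
  (minSeminorm A B).lift_of _ _ _

end MinTensor

end MinTensor

/-! ### Compact matrix quantum groups -/

/-- A compact matrix quantum group `(C(𝔾), u)`: a unital C*-algebra generated by the entries of a
matrix `u` such that `u` and its entrywise adjoint are invertible, together with the
comultiplication `Δ : C(𝔾) → C(𝔾) ⊗ C(𝔾)`, `Δ(u i j) = ∑ k, u i k ⊗ u k j`. -/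
structure CompactMatrixQuantumGroup (n : Type u) [Fintype n] [DecidableEq n] where
  algebra : Type u
  [cstarAlgebra : CStarAlgebra algebra]
  u : Matrix n n algebra
  adjoin_u : (StarAlgebra.adjoin ℂ {a | ∃ i j, u i j = a}).topologicalClosure = ⊤
  isUnit_u : IsUnit u
  isUnit_u_star : IsUnit (u.map star)
  comul : algebra →⋆ₐ[ℂ] MinTensor algebra algebra
  comul_u : ∀ i j, comul (u i j) = ∑ k, MinTensor.tmul (u i k) (u k j)

attribute [instance] CompactMatrixQuantumGroup.cstarAlgebra

/-- Isomorphism of compact quantum groups: a *-isomorphism of the C*-algebras that intertwines the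
comultiplications. -/
def CompactMatrixQuantumGroup.IsIsomorphic {n m : Type u} [Fintype n] [DecidableEq n] [Fintype m]
    [DecidableEq m] (G : CompactMatrixQuantumGroup n) (H : CompactMatrixQuantumGroup m) : Prop :=
  ∃ φ : G.algebra ≃⋆ₐ[ℂ] H.algebra, ∀ a : G.algebra,
    H.comul (φ a) = MinTensor.map φ.toStarAlgHom φ.toStarAlgHom (G.comul a)

/-! ### Quantum automorphism groups of colored graphs -/

section Qut

open FreeStarAlgebra

variable {V : Type u} [Fintype V] {C : Type*}

/-- The relations of the quantum automorphism group of the graph `X` with vertex coloring `c`, in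
the free *-algebra on self-adjoint generators `u i j`; each listed element is to vanish. -/
inductive QutRelation (X : SimpleGraph V) (c : V → C) : FreeStarAlgebra (V × V) → Prop
  | idempotent (i j : V) : QutRelation X c (ι (i, j) * ι (i, j) - ι (i, j))
  | row_sum (i : V) : QutRelation X c (∑ k, ι (i, k) - 1)
  | col_sum (j : V) : QutRelation X c (∑ k, ι (k, j) - 1)
  | edge_nonedge (i j k l : V) (hik : X.Adj i k) (hjl : ¬ X.Adj j l) :
      QutRelation X c (ι (i, j) * ι (k, l))
  | nonedge_edge (i j k l : V) (hik : ¬ X.Adj i k) (hjl : X.Adj j l) :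
      QutRelation X c (ι (i, j) * ι (k, l))
  | color (i j : V) (hij : c i ≠ c j) : QutRelation X c (ι (i, j))

/-- The same relations, for a matrix with entries in a C*-algebra. -/
structure IsQutMatrix {B : Type*} [CStarAlgebra B] (X : SimpleGraph V) (c : V → C)
    (b : Matrix V V B) : Prop where
  star_eq : ∀ i j, star (b i j) = b i j
  mul_self : ∀ i j, b i j * b i j = b i j
  row_sum : ∀ i, ∑ k, b i k = 1
  col_sum : ∀ j, ∑ k, b k j = 1
  edge_nonedge : ∀ i j k l, X.Adj i k → ¬ X.Adj j l → b i j * b k l = 0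
  nonedge_edge : ∀ i j k l, ¬ X.Adj i k → X.Adj j l → b i j * b k l = 0
  color : ∀ i j, c i ≠ c j → b i j = 0

/-- Projections in a C*-algebra that add up to `1` are pairwise orthogonal. -/
theorem mul_eq_zero_of_sum_eq_one {n : Type*} [Fintype n] [DecidableEq n] {B : Type*}
    [CStarAlgebra B] (p : n → B)
    (hs : ∀ i, star (p i) = p i) (hp : ∀ i, p i * p i = p i) (h1 : ∑ i, p i = 1) {i j : n}
    (hij : i ≠ j) : p i * p j = 0 := by
  let _ := CStarAlgebra.spectralOrder B
  let _ := CStarAlgebra.spectralOrderedRing B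
  have hsq : ∀ k, star (p k * p j) * (p k * p j) = p j * p k * p j := by
    intro k
    rw [star_mul, hs, hs, mul_assoc, ← mul_assoc (p k) (p k), hp, mul_assoc]
  have hsum : ∑ k ∈ Finset.univ.erase j, p j * p k * p j = 0 := by
    have h2 : ∑ k, p j * p k * p j = p j := by
      rw [← Finset.sum_mul, ← Finset.mul_sum, h1, mul_one, hp]
    rw [← Finset.add_sum_erase _ _ (Finset.mem_univ j), hp, hp] at h2
    simpa using h2
  have h0 := (Finset.sum_eq_zero_iff_of_nonneg (fun k _ => by
    rw [← hsq]; exact star_mul_self_nonneg _)).1 hsum i (by simp [hij])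
  rw [← hsq] at h0
  exact CStarRing.star_mul_self_eq_zero_iff _ |>.1 h0

namespace IsQutMatrix

variable {B : Type*} [CStarAlgebra B] {X : SimpleGraph V} {c : V → C} {b : Matrix V V B}

theorem row_orthogonal [DecidableEq V] (h : IsQutMatrix X c b) (i : V) {j k : V} (hjk : j ≠ k) :
    b i j * b i k = 0 :=
  mul_eq_zero_of_sum_eq_one (fun k => b i k) (h.star_eq i) (h.mul_self i) (h.row_sum i) hjk

theorem col_orthogonal [DecidableEq V] (h : IsQutMatrix X c b) (i : V) {j k : V} (hjk : j ≠ k) :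
    b j i * b k i = 0 :=
  mul_eq_zero_of_sum_eq_one (fun k => b k i) (fun k => h.star_eq k i) (fun k => h.mul_self k i)
    (h.col_sum i) hjk

theorem isUnit [DecidableEq V] (h : IsQutMatrix X c b) : IsUnit b := by
  refine ⟨⟨b, b.transpose, ?_, ?_⟩, rfl⟩
  · ext i j
    simp only [Matrix.mul_apply, Matrix.transpose_apply, Matrix.one_apply]
    split_ifs with hij
    · subst hij
      simp only [h.mul_self, h.row_sum]
    · exact Finset.sum_eq_zero fun k _ => h.col_orthogonal k hij
  · ext i j
    simp only [Matrix.mul_apply, Matrix.transpose_apply, Matrix.one_apply]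
    split_ifs with hij
    · subst hij
      simp only [h.mul_self, h.col_sum]
    · exact Finset.sum_eq_zero fun k _ => h.row_orthogonal k hij

theorem map_star_eq (h : IsQutMatrix X c b) : b.map star = b := by
  ext i j; exact h.star_eq i j

theorem eval_eq_zero (h : IsQutMatrix X c b) {r : FreeStarAlgebra (V × V)}
    (hr : QutRelation X c r) :
    eval (fun x : V × V => b x.1 x.2) (fun x => h.star_eq x.1 x.2) r = 0 := by
  cases hr with
  | idempotent i j => simp [h.mul_self]
  | row_sum i => simp [h.row_sum]
  | col_sum j => simp [h.col_sum]
  | edge_nonedge i j k l hik hjl => simpa using h.edge_nonedge i j k l hik hjl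
  | nonedge_edge i j k l hik hjl => simpa using h.nonedge_edge i j k l hik hjl
  | color i j hij => simpa using h.color i j hij

/-- The matrix `∑ k, b i k ⊗ b k j` satisfies the relations as well. -/
theorem comul {A : Type u} [CStarAlgebra A] {X : SimpleGraph V} {c : V → C} {b : Matrix V V A}
    (h : IsQutMatrix X c b) :
    IsQutMatrix X c (fun i j => ∑ k, MinTensor.tmul (b i k) (b k j)) := by
  classical
  have hmul : ∀ i j k l, (∑ m, MinTensor.tmul (b i m) (b m j)) *
      (∑ n, MinTensor.tmul (b k n) (b n l)) =
      ∑ m, ∑ n, MinTensor.tmul (b i m * b k n) (b m j * b n l) := by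
    intro i j k l
    simp only [Finset.sum_mul_sum, MinTensor.tmul_mul_tmul]
  constructor
  · intro i j
    rw [star_sum]
    exact Finset.sum_congr rfl fun k _ => by rw [MinTensor.star_tmul, h.star_eq, h.star_eq]
  · intro i j
    rw [hmul]
    refine Finset.sum_congr rfl fun m _ => ?_
    rw [Finset.sum_eq_single m, h.mul_self, h.mul_self]
    · intro n _ hn
      rw [h.row_orthogonal i hn.symm, MinTensor.zero_tmul]
    · simp
  · intro i
    rw [Finset.sum_comm]
    simp only [← MinTensor.tmul_sum, h.row_sum, ← MinTensor.sum_tmul, MinTensor.one_tmul_one]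
  · intro j
    rw [Finset.sum_comm]
    simp only [← MinTensor.sum_tmul, h.col_sum, ← MinTensor.tmul_sum, MinTensor.one_tmul_one]
  · intro i j k l hik hjl
    rw [hmul]
    refine Finset.sum_eq_zero fun m _ => Finset.sum_eq_zero fun n _ => ?_
    by_cases hmn : X.Adj m n
    · rw [h.edge_nonedge m j n l hmn hjl, MinTensor.tmul_zero]
    · rw [h.edge_nonedge i m k n hik hmn, MinTensor.zero_tmul]
  · intro i j k l hik hjl
    rw [hmul]
    refine Finset.sum_eq_zero fun m _ => Finset.sum_eq_zero fun n _ => ?_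
    by_cases hmn : X.Adj m n
    · rw [h.nonedge_edge i m k n hik hmn, MinTensor.zero_tmul]
    · rw [h.nonedge_edge m j n l hmn hjl, MinTensor.tmul_zero]
  · intro i j hij
    refine Finset.sum_eq_zero fun m _ => ?_
    by_cases him : c i = c m
    · rw [h.color m j (fun h' => hij (him.trans h')), MinTensor.tmul_zero]
    · rw [h.color i m him, MinTensor.zero_tmul]

end IsQutMatrix

/-- The universal C*-algebra `C(Qut_c(X))`. -/
def QutAlgebra (X : SimpleGraph V) (c : V → C) : Type u :=
  UniversalCStar {r | QutRelation X c r} fun x => QutRelation.idempotent x.1 x.2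

noncomputable instance (X : SimpleGraph V) (c : V → C) : CStarAlgebra (QutAlgebra X c) :=
  inferInstanceAs (CStarAlgebra (UniversalCStar _ _))

/-- The fundamental representation of `Qut_c(X)`, whose entries are the generators. -/
noncomputable def qutMatrix (X : SimpleGraph V) (c : V → C) : Matrix V V (QutAlgebra X c) :=
  fun i j => UniversalCStar.mk {r | QutRelation X c r} _ (ι (i, j))

theorem isQutMatrix_qutMatrix (X : SimpleGraph V) (c : V → C) :
    IsQutMatrix X c (qutMatrix X c) := by
  have h0 : ∀ {r}, QutRelation X c r → UniversalCStar.mk {r | QutRelation X c r}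
      (fun x => QutRelation.idempotent x.1 x.2) r = 0 :=
    fun hr => UniversalCStar.mk_eq_zero _ _ hr
  constructor
  · intro i j
    exact (StarHomClass.map_star (UniversalCStar.mk {r | QutRelation X c r}
      (fun x => QutRelation.idempotent x.1 x.2)) (ι (i, j))).symm.trans (by rw [star_ι]; rfl)
  · intro i j
    have := h0 (.idempotent i j)
    rw [map_sub, map_mul] at this
    exact sub_eq_zero.1 this
  · intro i
    have := h0 (.row_sum i)
    rw [map_sub, map_sum, map_one] at this
    exact sub_eq_zero.1 this
  · intro j
    have := h0 (.col_sum j)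
    rw [map_sub, map_sum, map_one] at this
    exact sub_eq_zero.1 this
  · intro i j k l hik hjl
    have := h0 (.edge_nonedge i j k l hik hjl)
    rwa [map_mul] at this
  · intro i j k l hik hjl
    have := h0 (.nonedge_edge i j k l hik hjl)
    rwa [map_mul] at this
  · intro i j hij
    exact h0 (.color i j hij)

/-- The universal property of `C(Qut_c(X))`. -/
noncomputable def qutLift {B : Type*} [CStarAlgebra B] (X : SimpleGraph V) (c : V → C)
    (b : Matrix V V B) (hb : IsQutMatrix X c b) : QutAlgebra X c →⋆ₐ[ℂ] B :=
  UniversalCStar.lift {r | QutRelation X c r} _ (fun x : V × V => b x.1 x.2)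
    (fun x => hb.star_eq x.1 x.2) fun _ hr => hb.eval_eq_zero hr

theorem qutLift_qutMatrix {B : Type*} [CStarAlgebra B] (X : SimpleGraph V) (c : V → C)
    (b : Matrix V V B) (hb : IsQutMatrix X c b) (i j : V) :
    qutLift X c b hb (qutMatrix X c i j) = b i j :=
  (UniversalCStar.lift_mk {r | QutRelation X c r} _ _ _ _ _).trans (eval_ι _ _ _)

variable [DecidableEq V]

/-- The quantum automorphism group `Qut_c(X)` of the graph `X` with vertex coloring `c`. -/
noncomputable def coloredQut (X : SimpleGraph V) (c : V → C) : CompactMatrixQuantumGroup V where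
  algebra := QutAlgebra X c
  u := qutMatrix X c
  adjoin_u := by
    have h : {a | ∃ i j, qutMatrix X c i j = a} = Set.range fun x : V × V =>
        UniversalCStar.mk {r | QutRelation X c r}
          (fun x => QutRelation.idempotent x.1 x.2) (ι x) := by
      ext a
      exact ⟨fun ⟨i, j, h⟩ => ⟨(i, j), h⟩, fun ⟨x, h⟩ => ⟨x.1, x.2, h⟩⟩
    exact (congrArg (fun s : Set (UniversalCStar {r | QutRelation X c r}
      (fun x => QutRelation.idempotent x.1 x.2)) =>
        (StarAlgebra.adjoin ℂ s).topologicalClosure) h).trans (UniversalCStar.adjoin_generators _ _)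
  isUnit_u := (isQutMatrix_qutMatrix X c).isUnit
  isUnit_u_star := by
    rw [(isQutMatrix_qutMatrix X c).map_star_eq]
    exact (isQutMatrix_qutMatrix X c).isUnit
  comul := qutLift X c _ (isQutMatrix_qutMatrix X c).comul
  comul_u i j := qutLift_qutMatrix X c _ _ i j

/-- The quantum automorphism group `Qut(X)` of a graph `X`; all vertices have the same color. -/
noncomputable def Qut (X : SimpleGraph V) : CompactMatrixQuantumGroup V :=
  coloredQut X fun _ => ()

/-- The quantum automorphism group `Qut_r(T)` of a graph `T` with root `r`: the root has one color
and all other vertices have another one. -/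
noncomputable def rootedQut (T : SimpleGraph V) (r : V) : CompactMatrixQuantumGroup V :=
  coloredQut T fun v => decide (v = r)

end Qut

/-! ### Rooted trees and rootification -/

section Rootification

/-- A finite rooted tree. -/
structure FiniteRootedTree where
  V : Type u
  [fintype : Fintype V]
  [decidableEq : DecidableEq V]
  graph : SimpleGraph V
  isTree : graph.IsTree
  root : V

attribute [instance] FiniteRootedTree.fintype FiniteRootedTree.decidableEq

variable {V : Type u}

/-- The graph obtained from `T` by subdividing the edge `e`, the new vertex being `none`. -/
def subdivideEdge (T : SimpleGraph V) (e : Sym2 V) : SimpleGraph (Option V) where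
  Adj a b :=
    match a, b with
    | some x, some y => T.Adj x y ∧ s(x, y) ≠ e
    | some x, none => x ∈ e
    | none, some y => y ∈ e
    | none, none => False
  symm := ⟨fun a b h => by
    match a, b, h with
    | some x, some y, h => exact ⟨h.1.symm, by rw [Sym2.eq_swap]; exact h.2⟩
    | some x, none, h => exact h
    | none, some y, h => exact h⟩
  loopless := ⟨fun a h => by
    match a, h with
    | some x, h => exact T.irrefl h.1⟩

theorem reachable_of_map {V W : Type u} {G : SimpleGraph V} {H : SimpleGraph W} (f : V → W)
    (hf : ∀ a b, G.Adj a b → H.Reachable (f a) (f b)) {a b : V} (h : G.Reachable a b) :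
    H.Reachable (f a) (f b) := by
  obtain ⟨w⟩ := h
  induction w with
  | nil => exact SimpleGraph.Reachable.refl _
  | cons h _ ih => exact (hf _ _ h).trans ih

theorem isTree_subdivideEdge {T : SimpleGraph V} (hT : T.IsTree) {e : Sym2 V}
    (he : e ∈ T.edgeSet) : (subdivideEdge T e).IsTree := by
  refine ⟨?_, SimpleGraph.isAcyclic_iff_forall_adj_isBridge.2 ?_⟩
  · -- connectedness
    induction e with | _ x y => ?_
    have key : ∀ a b, T.Adj a b → (subdivideEdge T s(x, y)).Reachable (some a) (some b) := by
      intro a b hab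
      by_cases h : s(a, b) = s(x, y)
      · have ha : (subdivideEdge T s(x, y)).Adj (some a) none := by
          change a ∈ s(x, y); rw [← h]; exact Sym2.mem_mk_left a b
        have hb : (subdivideEdge T s(x, y)).Adj none (some b) := by
          change b ∈ s(x, y); rw [← h]; exact Sym2.mem_mk_right a b
        exact ha.reachable.trans hb.reachable
      · exact SimpleGraph.Adj.reachable (show _ ∧ _ from ⟨hab, h⟩)
    have key3 : (subdivideEdge T s(x, y)).Adj none (some x) := Sym2.mem_mk_left x y
    have key4 : ∀ a, (subdivideEdge T s(x, y)).Reachable a (some x) := by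
      rintro (_ | a)
      · exact key3.reachable
      · exact reachable_of_map some key (hT.connected.preconnected a x)
    exact ⟨fun a b => (key4 a).trans (key4 b).symm⟩
  · -- every edge is a bridge
    have hbr := SimpleGraph.isAcyclic_iff_forall_adj_isBridge.1 hT.isAcyclic
    have hnew : ∀ a, a ∈ e → ¬ ((subdivideEdge T e).deleteEdges {s(some a, none)}).Reachable
        (some a) none := by
      intro x hx hr
      obtain ⟨y, rfl⟩ := hx
      have hxy : T.Adj x y := he
      refine SimpleGraph.isBridge_iff.1 (hbr hxy)
        (reachable_of_map (fun o => Option.getD o y) ?_ hr)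
      rintro (_ | c) (_ | d) h <;> rw [SimpleGraph.deleteEdges_adj] at h
      · rcases Sym2.mem_iff.1 (show d ∈ s(x, y) from h.1) with rfl | rfl
        · exact absurd Sym2.eq_swap h.2
        · exact SimpleGraph.Reachable.refl _
      · rcases Sym2.mem_iff.1 (show c ∈ s(x, y) from h.1) with rfl | rfl
        · exact absurd rfl h.2
        · exact SimpleGraph.Reachable.refl _
      · exact SimpleGraph.Adj.reachable (SimpleGraph.deleteEdges_adj.2 h.1)
    rintro (_ | a) (_ | b) h <;> rw [SimpleGraph.isBridge_iff]
    · exact absurd h (SimpleGraph.irrefl _)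
    · intro hr
      rw [Sym2.eq_swap] at hr
      exact hnew b h hr.symm
    · exact hnew a h
    · intro hr
      induction e with | _ x y => ?_
      have hxy : T.Adj x y := he
      have hne : s(a, b) ≠ s(x, y) := h.2
      have hD : (T.deleteEdges {s(a, b)}).Adj x y :=
        SimpleGraph.deleteEdges_adj.2 ⟨hxy, fun h' => hne h'.symm⟩
      refine SimpleGraph.isBridge_iff.1 (hbr h.1)
        (reachable_of_map (fun o => Option.getD o x) ?_ hr)
      rintro (_ | c) (_ | d) h <;> rw [SimpleGraph.deleteEdges_adj] at h
      · rcases Sym2.mem_iff.1 (show d ∈ s(x, y) from h.1) with rfl | rfl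
        · exact SimpleGraph.Reachable.refl _
        · exact hD.reachable
      · rcases Sym2.mem_iff.1 (show c ∈ s(x, y) from h.1) with rfl | rfl
        · exact SimpleGraph.Reachable.refl _
        · exact hD.symm.reachable
      · refine SimpleGraph.Adj.reachable (SimpleGraph.deleteEdges_adj.2 ⟨h.1.1, fun h' => h.2 ?_⟩)
        have := congrArg (Sym2.map some) (Set.mem_singleton_iff.1 h')
        simpa using this

/-- In a tree, a vertex `w` on the path from `u` to `v`, different from both, is closer to any
vertex `x` than `u` or `v`. -/
theorem isTree_dist_lt {T : SimpleGraph V} (hT : T.IsTree) {u v w : V} {q : T.Walk u v}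
    (hq : q.IsPath) (hw : w ∈ q.support) (hwu : w ≠ u) (hwv : w ≠ v) (x : V) :
    T.edist w x < T.edist u x ∨ T.edist w x < T.edist v x := by
  classical
  have aux : ∀ {a : V} (p : T.Walk a x), p.IsPath → w ≠ a → w ∈ p.support →
      p.length = T.dist a x → T.edist w x < T.edist a x := by
    intro a p hp hwa hwp hl
    have h1 : T.dist w x ≤ (p.dropUntil w hwp).length := SimpleGraph.dist_le _
    have h2 : (p.dropUntil w hwp).length < p.length := by
      have := congrArg SimpleGraph.Walk.length (p.take_spec hwp)
      rw [SimpleGraph.Walk.length_append] at this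
      have h0 : (p.takeUntil w hwp).length ≠ 0 := fun h =>
        hwa (SimpleGraph.Walk.eq_of_length_eq_zero h).symm
      omega
    rw [← (hT.connected w x).coe_dist_eq_edist, ← (hT.connected a x).coe_dist_eq_edist]
    exact_mod_cast (by omega : T.dist w x < T.dist a x)
  obtain ⟨p₁, hp₁, hl₁⟩ := hT.connected.exists_path_of_dist u x
  obtain ⟨p₂, hp₂, hl₂⟩ := hT.connected.exists_path_of_dist v x
  by_cases h1 : w ∈ p₁.support
  · exact Or.inl (aux p₁ hp₁ hwu h1 hl₁)
  by_cases h2 : w ∈ p₂.support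
  · exact Or.inr (aux p₂ hp₂ hwv h2 hl₂)
  exfalso
  have hb : ((p₁.append p₂.reverse).bypass) = q :=
    congrArg Subtype.val ((hT.isAcyclic.subsingleton_path u v).elim
      ⟨_, SimpleGraph.Walk.bypass_isPath _⟩ ⟨q, hq⟩)
  have h3 : w ∈ (p₁.append p₂.reverse).support :=
    SimpleGraph.Walk.support_bypass_subset_support _ (hb ▸ hw)
  rw [SimpleGraph.Walk.mem_support_append_iff, SimpleGraph.Walk.support_reverse,
    List.mem_reverse] at h3
  exact h3.elim h1 h2

theorem isTree_center_adj [Finite V] {T : SimpleGraph V} (hT : T.IsTree) {u v : V}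
    (hu : u ∈ T.center) (hv : v ∈ T.center) (huv : u ≠ v) : T.Adj u v := by
  classical
  obtain ⟨q, hq, hl⟩ := hT.connected.exists_path_of_dist u v
  cases q with
  | nil => exact absurd rfl huv
  | @cons _ w _ h q' =>
    by_cases hwv : w = v
    · exact hwv ▸ h
    exfalso
    have hw : w ∈ (SimpleGraph.Walk.cons h q').support := by simp
    obtain ⟨x, hx⟩ := T.exists_edist_eq_eccent_of_finite w
    have hle : T.radius ≤ T.edist w x := by rw [hx]; exact SimpleGraph.radius_le_eccent
    rw [SimpleGraph.mem_center_iff] at hu hv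
    rcases isTree_dist_lt hT hq hw h.ne.symm hwv x with h1 | h1
    · exact absurd (h1.trans_le (SimpleGraph.edist_le_eccent.trans hu.le)) (not_lt.2 hle)
    · exact absurd (h1.trans_le (SimpleGraph.edist_le_eccent.trans hv.le)) (not_lt.2 hle)

/-- The center of a finite tree is a single vertex or the set of the two ends of an edge. -/
theorem isTree_center [Finite V] {T : SimpleGraph V} (hT : T.IsTree) :
    (∃ z, T.center = {z}) ∨ ∃ e ∈ T.edgeSet, T.center = {x | x ∈ e} := by
  classical
  have := hT.connected.nonempty
  obtain ⟨z, hz⟩ := T.center_nonempty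
  by_cases h : ∃ y ∈ T.center, y ≠ z
  · obtain ⟨y, hy, hyz⟩ := h
    right
    have hadj := isTree_center_adj hT hz hy hyz.symm
    refine ⟨s(z, y), hadj, Set.ext fun x => ⟨fun hx => ?_, fun hx => ?_⟩⟩
    · by_contra hc
      simp only [Set.mem_ofPred_eq, Sym2.mem_iff, not_or] at hc
      have h1 := isTree_center_adj hT hx hz hc.1
      have h2 := isTree_center_adj hT hx hy hc.2
      -- a triangle
      have hp : (SimpleGraph.Walk.cons h1 (SimpleGraph.Walk.cons hadj .nil)).IsPath := by
        simp [SimpleGraph.Walk.isPath_def, hc.1, hc.2, hyz.symm]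
      have hp' : (SimpleGraph.Walk.cons h2 .nil).IsPath := by
        simp [SimpleGraph.Walk.isPath_def, hc.2]
      have := congrArg (fun p => p.1.length) ((hT.isAcyclic.subsingleton_path x y).elim ⟨_, hp⟩ ⟨_, hp'⟩)
      simp at this
    · simp only [Set.mem_ofPred_eq, Sym2.mem_iff] at hx
      rcases hx with rfl | rfl
      · exact hz
      · exact hy
  · left
    refine ⟨z, Set.eq_singleton_iff_unique_mem.2 ⟨hz, fun y hy => ?_⟩⟩
    by_contra hyz
    exact h ⟨y, hy, hyz⟩

open Classical in
/-- The rootification of a finite tree: if the center is a single vertex, the tree is rooted at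
that vertex; otherwise the center consists of the two ends of an edge, which is subdivided, and the
new vertex becomes the root. -/
noncomputable def rootification [Fintype V] [DecidableEq V] (T : SimpleGraph V) (hT : T.IsTree) :
    FiniteRootedTree.{u} :=
  if h : ∃ z, T.center = {z} then
    { V := V, graph := T, isTree := hT, root := h.choose }
  else
    have he : ∃ e ∈ T.edgeSet, T.center = {x | x ∈ e} := (isTree_center hT).resolve_left h
    { V := Option V
      graph := subdivideEdge T he.choose
      isTree := isTree_subdivideEdge hT he.choose_spec.1
      root := none }

end Rootification

/-! The defining matrix `u` of a quantum automorphism group respects distance. If `i` and `k` are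
joined by a walk of some length and `j` and `l` by none of that length, then `u i j * u k l = 0`:
insert row sums along the walk and apply the adjacency relations term by term
(`mul_eq_zero_of_walk`). Hence `u i j = 0` whenever `i` and `j` have different eccentricities, and
in particular whenever exactly one of them is central (`eq_zero_of_center`). This is the quantum
version of the fact that automorphisms preserve the center.

If the center is a single vertex, giving it its own color therefore imposes nothing new, and the two
algebras have the same relations. If the center consists of the two ends of an edge `e`, bordering
`u` with a diagonal block `1` for the new vertex gives a matrix for the subdivided graph
(`IsQutMatrix.extendByOne`). Conversely, the color relation puts a matrix for the rooted subdivided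
graph into this block form, and deleting the block recovers a matrix for the original graph
(`IsQutMatrix.restrict`). Both directions rest on `u i j = 0` when exactly one of `i`, `j` lies on
`e`. For the original graph this is preservation of the center; for the subdivided graph it holds
because the ends of `e` are exactly the neighbors of the fixed root.

The universal property turns the two constructions into mutually inverse *-homomorphisms, and
everything else is checked on generators (`isIsomorphic_of_generators`). Acyclicity enters only
through the shape of the center, `isTree_center`, and the construction of the rootification. -/

/-! ### Isomorphisms of compact matrix quantum groups from generators -/

namespace CompactMatrixQuantumGroup

variable {n m : Type u} [Fintype n] [DecidableEq n] [Fintype m] [DecidableEq m]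

/-- Two *-homomorphisms on `C(𝔾)` that agree on the entries of the fundamental representation are
equal. -/
theorem algHom_ext (G : CompactMatrixQuantumGroup n) {B : Type*} [CStarAlgebra B]
    {f g : G.algebra →⋆ₐ[ℂ] B} (h : ∀ i j, f (G.u i j) = g (G.u i j)) : f = g := by
  -- *-homomorphisms of C*-algebras are contractive, hence continuous. The equalizer is thus a
  -- closed *-subalgebra, and it contains the generators of a dense one.
  have hc : ∀ f : G.algebra →⋆ₐ[ℂ] B, Continuous f := fun f =>
    AddMonoidHomClass.continuous_of_bound f 1 fun a => by
      rw [one_mul]; exact NonUnitalStarAlgHom.norm_apply_le f a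
  have hle : StarAlgebra.adjoin ℂ {a | ∃ i j, G.u i j = a} ≤ StarAlgHom.equalizer f g :=
    StarAlgHom.adjoin_le_equalizer f g (by rintro _ ⟨i, j, rfl⟩; exact h i j)
  have htop : (StarAlgebra.adjoin ℂ {a | ∃ i j, G.u i j = a}).topologicalClosure ≤
      StarAlgHom.equalizer f g :=
    StarSubalgebra.topologicalClosure_minimal hle (isClosed_eq (hc f) (hc g))
  rw [G.adjoin_u] at htop
  exact StarAlgHom.ext fun a => htop (StarSubalgebra.mem_top (x := a))

/-- Two *-homomorphisms that are inverse to each other and compatible with the comultiplications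
on the entries of the fundamental representations give an isomorphism. -/
theorem isIsomorphic_of_generators {G : CompactMatrixQuantumGroup n}
    {H : CompactMatrixQuantumGroup m} (f : G.algebra →⋆ₐ[ℂ] H.algebra)
    (g : H.algebra →⋆ₐ[ℂ] G.algebra) (hgf : ∀ i j, g (f (G.u i j)) = G.u i j)
    (hfg : ∀ i j, f (g (H.u i j)) = H.u i j)
    (hcomul : ∀ i j, H.comul (f (G.u i j)) =
      ∑ k, MinTensor.tmul (f (G.u i k)) (f (G.u k j))) : G.IsIsomorphic H := by
  refine ⟨StarAlgEquiv.ofStarAlgHom f g (G.algHom_ext hgf) (H.algHom_ext hfg), fun a => ?_⟩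
  -- Both sides are *-homomorphisms out of `G.algebra`, so the intertwining identity need only be
  -- compared on the entries of `G.u`.
  have key : H.comul.comp f = (MinTensor.map f f).comp G.comul := by
    refine G.algHom_ext fun i j => ?_
    rw [StarAlgHom.comp_apply, StarAlgHom.comp_apply, hcomul, G.comul_u, map_sum]
    exact Finset.sum_congr rfl fun k _ => (MinTensor.map_tmul f f _ _).symm
  exact congrArg (fun φ : G.algebra →⋆ₐ[ℂ] MinTensor H.algebra H.algebra => φ a) key

end CompactMatrixQuantumGroup

/-! ### Distance, eccentricity and center -/

namespace IsQutMatrix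

variable {V : Type u} [Fintype V] {C : Type*} {B : Type*} [CStarAlgebra B]
  {X : SimpleGraph V} {c : V → C} {b : Matrix V V B}

/-- The relations are symmetric in rows and columns, the two adjacency relations trading places.
This lets an inequality between the row and column vertex be proved in one direction only. -/
theorem transpose (h : IsQutMatrix X c b) : IsQutMatrix X c b.transpose where
  star_eq i j := h.star_eq j i
  mul_self i j := h.mul_self j i
  row_sum := h.col_sum
  col_sum := h.row_sum
  edge_nonedge i j k l hik hjl := h.nonedge_edge j i l k hjl hik
  nonedge_edge i j k l hik hjl := h.edge_nonedge j i l k hjl hik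
  color i j hij := h.color j i hij.symm

/-- The relations except for those on the coloring do not depend on the coloring. -/
theorem recolor (h : IsQutMatrix X c b) {D : Type*} {d : V → D}
    (hd : ∀ i j, d i ≠ d j → b i j = 0) : IsQutMatrix X d b :=
  { h with color := hd }

/-- If there is a walk from `i` to `k`, but no walk of the same length from `j` to `l`, then the
entries at `(i, j)` and `(k, l)` are orthogonal. -/
theorem mul_eq_zero_of_walk (h : IsQutMatrix X c b) {i k : V} (p : X.Walk i k) (j l : V)
    (hjl : ∀ q : X.Walk j l, q.length ≠ p.length) : b i j * b k l = 0 := by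
  classical
  induction p generalizing j with
  | nil => exact h.row_orthogonal _ fun hj => by subst hj; exact hjl .nil rfl
  | @cons i w k hiw p ih =>
    -- Insert `1 = ∑ x, b w x` between the factors. If `x` is adjacent to `j`, a walk from `x` to
    -- `l` of the length of the tail would extend to a forbidden walk from `j`, so the induction
    -- hypothesis applies; otherwise the first two factors are already orthogonal.
    rw [← one_mul (b k l), ← h.row_sum w, Finset.sum_mul, Finset.mul_sum]
    refine Finset.sum_eq_zero fun x _ => ?_
    by_cases hjx : X.Adj j x
    · rw [ih x fun q hq => hjl (.cons hjx q) (by simp [hq]), mul_zero]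
    · rw [← mul_assoc, h.edge_nonedge i j w x hiw hjx, zero_mul]

/-- A shortest walk from `i` to `k` is too short to have a counterpart from `j` to `l`. The strict
inequality makes the first distance finite, so such a walk exists even without connectedness. -/
theorem mul_eq_zero_of_edist_lt (h : IsQutMatrix X c b) {i j k l : V}
    (hd : X.edist i k < X.edist j l) : b i j * b k l = 0 := by
  obtain ⟨p, hp⟩ := SimpleGraph.exists_walk_of_edist_ne_top hd.ne_top
  refine h.mul_eq_zero_of_walk p j l fun q hq => ?_
  exact absurd (q.edist_le.trans_eq (by rw [hq, hp])) (not_le.2 hd)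

/-- Choose `l` at maximal distance from `j`. No vertex `k` is that far from `i`, so `b i j` is
orthogonal to every entry of column `l`, and these entries add up to `1`. -/
theorem eq_zero_of_eccent_lt (h : IsQutMatrix X c b) {i j : V} (hij : X.eccent i < X.eccent j) :
    b i j = 0 := by
  obtain ⟨l, hl⟩ := X.exists_edist_eq_eccent_of_finite j
  rw [← mul_one (b i j), ← h.col_sum l, Finset.mul_sum]
  refine Finset.sum_eq_zero fun k _ => h.mul_eq_zero_of_edist_lt ?_
  rw [hl]
  exact SimpleGraph.edist_le_eccent.trans_lt hij

/-- The entries at pairs of vertices of different eccentricity vanish. -/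
theorem eq_zero_of_eccent_ne (h : IsQutMatrix X c b) {i j : V} (hij : X.eccent i ≠ X.eccent j) :
    b i j = 0 :=
  hij.lt_or_gt.elim h.eq_zero_of_eccent_lt h.transpose.eq_zero_of_eccent_lt

theorem eq_zero_of_center (h : IsQutMatrix X c b) {i j : V}
    (hij : ¬ (i ∈ X.center ↔ j ∈ X.center)) : b i j = 0 :=
  h.eq_zero_of_eccent_ne fun he => hij (by
    rw [SimpleGraph.mem_center_iff, SimpleGraph.mem_center_iff, he])

end IsQutMatrix

/-! ### Center a single vertex: coloring it is free -/

section Recoloring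

variable {V : Type u} [Fintype V] [DecidableEq V]

/-- If the center is a single vertex, distinguishing it by a color does not change the quantum
automorphism group. -/
theorem Qut_isIsomorphic_rootedQut (X : SimpleGraph V) {z : V} (hz : X.center = {z}) :
    (Qut X).IsIsomorphic (rootedQut X z) := by
  -- The new color relation concerns the entries with exactly one index equal to `z`, that is,
  -- exactly one central index. These vanish already in the uncolored algebra.
  have hX := (isQutMatrix_qutMatrix X fun _ => ()).recolor (d := fun v => decide (v = z))
    fun i j hij => (isQutMatrix_qutMatrix X _).eq_zero_of_center (by
      rw [hz, Set.mem_singleton_iff, Set.mem_singleton_iff]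
      exact fun h => hij (decide_eq_decide.2 h))
  have hr := (isQutMatrix_qutMatrix X fun v => decide (v = z)).recolor (d := fun _ => ())
    fun i j hij => absurd rfl hij
  have hf := qutLift_qutMatrix X (fun _ => ()) _ hr
  have hg := qutLift_qutMatrix X (fun v => decide (v = z)) _ hX
  refine CompactMatrixQuantumGroup.isIsomorphic_of_generators (G := Qut X) (H := rootedQut X z)
    (qutLift X _ _ hr) (qutLift X _ _ hX) (fun i j => ?_) (fun i j => ?_) (fun i j => ?_)
  · exact (congrArg _ (hf i j)).trans (hg i j)
  · exact (congrArg _ (hg i j)).trans (hf i j)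
  · refine (congrArg _ (hf i j)).trans (((rootedQut X z).comul_u i j).trans ?_)
    exact Finset.sum_congr rfl fun k _ =>
      (congrArg₂ MinTensor.tmul (hf i k) (hf k j)).symm

end Recoloring

/-! ### Center the two ends of an edge: subdividing it -/

section Subdivision

variable {V : Type u}

/-- The block matrix with blocks `1` and `b`. -/
def extendByOne {B : Type*} [Zero B] [One B] (b : Matrix V V B) : Matrix (Option V) (Option V) B
  | none, none => 1
  | none, some _ => 0
  | some _, none => 0
  | some i, some j => b i j

theorem not_and_mem_of_sym2_ne {e : Sym2 V} {x y : V} (hxy : x ≠ y) (h : s(x, y) ≠ e) :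
    ¬ (x ∈ e ∧ y ∈ e) :=
  fun hm => h ((Sym2.mem_and_mem_iff hxy).1 hm).symm

variable [Fintype V] {B : Type*} [CStarAlgebra B]

/-- Relations involving the new vertex reduce to `b i j = 0` when exactly one of `i`, `j` is on `e`,
which is preservation of the center. Among old vertices only `e` changes status, from edge to
non-edge, so the new conditions say that `e` is orthogonal to all other edges. -/
theorem IsQutMatrix.extendByOne [DecidableEq V] {T : SimpleGraph V} {C : Type*} {c : V → C}
    {b : Matrix V V B} (h : IsQutMatrix T c b) {e : Sym2 V} (hc : T.center = {x | x ∈ e}) :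
    IsQutMatrix (subdivideEdge T e) (fun v => decide (v = none)) (extendByOne b) := by
  have h0 : ∀ {i j}, ¬ (i ∈ e ↔ j ∈ e) → b i j = 0 := fun {i j} hij =>
    h.eq_zero_of_center (by rw [hc]; exact hij)
  -- An edge other than `e` has an end off `e`, while `j` and `l` are both on it. At that end the
  -- corresponding factor has exactly one index on `e` and vanishes.
  have hedge : ∀ i j k l, T.Adj i k → s(i, k) ≠ e → s(j, l) = e → b i j * b k l = 0 := by
    rintro i j k l hik hne rfl
    by_cases hi : i ∈ s(j, l)
    · have hk : k ∉ s(j, l) := fun hk => not_and_mem_of_sym2_ne hik.ne hne ⟨hi, hk⟩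
      rw [h0 (i := k) (j := l) fun hkl => hk (hkl.2 (Sym2.mem_mk_right _ _)), mul_zero]
    · rw [h0 (i := i) (j := j) fun hij => hi (hij.2 (Sym2.mem_mk_left _ _)), zero_mul]
  have hedge' : ∀ i j k l, s(i, k) = e → T.Adj j l → s(j, l) ≠ e → b i j * b k l = 0 := by
    rintro i j k l rfl hjl hne
    by_cases hj : j ∈ s(i, k)
    · have hl : l ∉ s(i, k) := fun hl => not_and_mem_of_sym2_ne hjl.ne hne ⟨hj, hl⟩
      rw [h0 (i := k) (j := l) fun hkl => hl (hkl.1 (Sym2.mem_mk_right _ _)), mul_zero]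
    · rw [h0 (i := i) (j := j) fun hij => hj (hij.1 (Sym2.mem_mk_left _ _)), zero_mul]
  constructor
  · rintro (_ | i) (_ | j)
    · exact star_one B
    · exact star_zero B
    · exact star_zero B
    · exact h.star_eq i j
  · rintro (_ | i) (_ | j)
    · exact one_mul 1
    · exact mul_zero 0
    · exact mul_zero 0
    · exact h.mul_self i j
  · rintro (_ | i) <;> simp [Fintype.sum_option, _root_.extendByOne, h.row_sum]
  · rintro (_ | j) <;> simp [Fintype.sum_option, _root_.extendByOne, h.col_sum]
  · rintro (_ | i) (_ | j) (_ | k) (_ | l) hik hjl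
    · exact absurd hik (SimpleGraph.irrefl _)
    · exact mul_zero _
    · exact mul_zero _
    -- One factor is the block `1`; adjacency to `none` means lying on `e`, so the other factor
    -- mixes an end of `e` with a vertex off `e`.
    · exact (one_mul _).trans (h0 fun hkl => hjl (hkl.1 hik))
    · exact zero_mul _
    · exact zero_mul _
    · exact zero_mul _
    · exact zero_mul _
    · exact zero_mul _
    · exact zero_mul _
    · exact zero_mul _
    · exact zero_mul _
    · exact (mul_one _).trans (h0 fun hij => hjl (hij.1 hik))
    · exact mul_zero _
    · exact mul_zero _
    · by_cases hT : T.Adj j l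
      · exact hedge i j k l hik.1 hik.2 (by_contra fun hne => hjl ⟨hT, hne⟩)
      · exact h.edge_nonedge i j k l hik.1 hT
  · rintro (_ | i) (_ | j) (_ | k) (_ | l) hik hjl
    · exact absurd hjl (SimpleGraph.irrefl _)
    · exact mul_zero _
    · exact mul_zero _
    · exact (one_mul _).trans (h0 fun hkl => hik (hkl.2 hjl))
    · exact zero_mul _
    · exact zero_mul _
    · exact zero_mul _
    · exact zero_mul _
    · exact zero_mul _
    · exact zero_mul _
    · exact zero_mul _
    · exact zero_mul _
    · exact (mul_one _).trans (h0 fun hij => hik (hij.2 hjl))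
    · exact mul_zero _
    · exact mul_zero _
    · by_cases hT : T.Adj i k
      · exact hedge' i j k l (by_contra fun hne => hik ⟨hT, hne⟩) hjl.1 hjl.2
      · exact h.nonedge_edge i j k l hT hjl.1
  · rintro (_ | i) (_ | j) hij
    · exact absurd rfl hij
    · rfl
    · rfl
    · exact absurd (by simp) hij

variable {W : SimpleGraph (Option V)} {b : Matrix (Option V) (Option V) B}

theorem IsQutMatrix.none_some [DecidableEq V]
    (h : IsQutMatrix W (fun v => decide (v = none)) b) (j : V) : b none (some j) = 0 :=
  h.color _ _ (by simp)

theorem IsQutMatrix.some_none [DecidableEq V]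
    (h : IsQutMatrix W (fun v => decide (v = none)) b) (i : V) : b (some i) none = 0 :=
  h.color _ _ (by simp)

theorem IsQutMatrix.none_none [DecidableEq V]
    (h : IsQutMatrix W (fun v => decide (v = none)) b) : b none none = 1 := by
  have := h.row_sum none
  simpa only [Fintype.sum_option, h.none_some, Finset.sum_const_zero, add_zero] using this

/-- The root entry is `1`, so multiplying by it is harmless, and the adjacency relations with the
root force entries to respect membership in `e`. This replaces the eccentricity argument and
restores the relations for `e`, which is no longer an edge after subdivision. -/
theorem IsQutMatrix.restrict [DecidableEq V] {T : SimpleGraph V} {e : Sym2 V} (he : e ∈ T.edgeSet)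
    {b : Matrix (Option V) (Option V) B}
    (h : IsQutMatrix (subdivideEdge T e) (fun v => decide (v = none)) b) :
    IsQutMatrix T (fun _ => ()) (b.submatrix some some) := by
  have h0 : ∀ {i j}, ¬ (i ∈ e ↔ j ∈ e) → b (some i) (some j) = 0 := by
    intro i j hij
    by_cases hi : i ∈ e
    · rw [← mul_one (b (some i) (some j)), ← h.none_none]
      exact h.edge_nonedge _ _ _ _ hi fun hj => hij (iff_of_true hi hj)
    · rw [← mul_one (b (some i) (some j)), ← h.none_none]
      exact h.nonedge_edge _ _ _ _ hi (not_not.1 fun hj => hij (iff_of_false hi hj))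
  constructor
  · exact fun i j => h.star_eq _ _
  · exact fun i j => h.mul_self _ _
  · intro i
    have := h.row_sum (some i)
    rwa [Fintype.sum_option, h.some_none, zero_add] at this
  · intro j
    have := h.col_sum (some j)
    rwa [Fintype.sum_option, h.none_some, zero_add] at this
  · intro i j k l hik hjl
    rw [Matrix.submatrix_apply, Matrix.submatrix_apply]
    by_cases hne : s(i, k) = e
    · by_cases hj : j ∈ e
      · by_cases hl : l ∈ e
        -- With `j` and `l` both on `e`, either they coincide and the product consists of two
        -- distinct entries of one column, or they span `e` and so are adjacent in `T`, contrary to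
        -- `hjl`.
        · by_cases hjl' : j = l
          · subst hjl'
            exact h.col_orthogonal _ fun hc => hik.ne (Option.some_injective _ hc)
          · rw [(Sym2.mem_and_mem_iff hjl').1 ⟨hj, hl⟩] at he
            exact absurd he hjl
        · rw [h0 (i := k) (j := l) fun hkl => hl (hkl.1 (hne ▸ Sym2.mem_mk_right _ _)), mul_zero]
      · rw [h0 (i := i) (j := j) fun hij => hj (hij.1 (hne ▸ Sym2.mem_mk_left _ _)), zero_mul]
    · exact h.edge_nonedge _ _ _ _ ⟨hik, hne⟩ fun hc => hjl hc.1
  · intro i j k l hik hjl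
    rw [Matrix.submatrix_apply, Matrix.submatrix_apply]
    by_cases hne : s(j, l) = e
    · by_cases hi : i ∈ e
      · by_cases hk : k ∈ e
        · by_cases hik' : i = k
          · subst hik'
            exact h.row_orthogonal _ fun hc => hjl.ne (Option.some_injective _ hc)
          · rw [(Sym2.mem_and_mem_iff hik').1 ⟨hi, hk⟩] at he
            exact absurd he hik
        · rw [h0 (i := k) (j := l) fun hkl => hk (hkl.2 (hne ▸ Sym2.mem_mk_right _ _)), mul_zero]
      · rw [h0 (i := i) (j := j) fun hij => hi (hij.2 (hne ▸ Sym2.mem_mk_left _ _)), zero_mul]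
    · exact h.nonedge_edge _ _ _ _ (fun hc => hik hc.1) ⟨hjl, hne⟩
  · exact fun i j hij => absurd rfl hij

/-- If the center consists of the two ends of an edge, subdividing this edge and distinguishing the
new vertex by a color does not change the quantum automorphism group. -/
theorem Qut_isIsomorphic_rootedQut_subdivideEdge [DecidableEq V] (T : SimpleGraph V) {e : Sym2 V}
    (he : e ∈ T.edgeSet) (hc : T.center = {x | x ∈ e}) :
    (Qut T).IsIsomorphic (rootedQut (subdivideEdge T e) none) := by
  have hu := isQutMatrix_qutMatrix (subdivideEdge T e) fun v => decide (v = none)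
  have hX := (isQutMatrix_qutMatrix T fun _ => ()).extendByOne hc
  have hr := hu.restrict he
  have hf := qutLift_qutMatrix T (fun _ => ()) _ hr
  have hg := qutLift_qutMatrix (subdivideEdge T e) (fun v => decide (v = none)) _ hX
  refine CompactMatrixQuantumGroup.isIsomorphic_of_generators (G := Qut T)
    (H := rootedQut (subdivideEdge T e) none)
    (qutLift T _ _ hr) (qutLift (subdivideEdge T e) _ _ hX)
    (fun i j => ?_) (fun i j => ?_) (fun i j => ?_)
  · exact (congrArg _ (hf i j)).trans (hg (some i) (some j))
  · refine (congrArg _ (hg i j)).trans ?_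
    match i, j with
    | none, none => exact (map_one (qutLift T _ _ hr)).trans hu.none_none.symm
    | none, some j => exact (map_zero (qutLift T _ _ hr)).trans (hu.none_some j).symm
    | some i, none => exact (map_zero (qutLift T _ _ hr)).trans (hu.some_none i).symm
    | some i, some j => exact hf i j
  · refine (congrArg _ (hf i j)).trans
      (((rootedQut (subdivideEdge T e) none).comul_u (some i) (some j)).trans ?_)
    -- The sum for the comultiplication of the larger matrix has one extra term, through the root;
    -- it vanishes because the matrix is block diagonal.
    have h0 : MinTensor.tmul ((rootedQut (subdivideEdge T e) none).u (some i) none)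
        ((rootedQut (subdivideEdge T e) none).u none (some j)) = 0 :=
      (congrArg (fun a => MinTensor.tmul a _) (hu.some_none i)).trans (MinTensor.zero_tmul _)
    rw [Fintype.sum_option, h0, zero_add]
    exact Finset.sum_congr rfl fun k _ =>
      (congrArg₂ MinTensor.tmul (hf i k) (hf k j)).symm

end Subdivision

theorem mainTheorem2 {V : Type u} [Fintype V] [DecidableEq V] (T : SimpleGraph V)
    (hT : T.IsTree) :
    (Qut T).IsIsomorphic
      (rootedQut (rootification T hT).graph (rootification T hT).root) := by
  by_cases h : ∃ z, T.center = {z}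
  · rw [show rootification T hT = _ from dif_pos h]
    exact Qut_isIsomorphic_rootedQut T h.choose_spec
  -- This restates the existence claim used inside `rootification`; by proof irrelevance `he.choose`
  -- is the very edge subdivided there.
  · have he : ∃ e ∈ T.edgeSet, T.center = {x | x ∈ e} := (isTree_center hT).resolve_left h
    rw [show rootification T hT = _ from dif_neg h]
    exact Qut_isIsomorphic_rootedQut_subdivideEdge T he.choose_spec.1 he.choose_spec.2
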